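/- Consider the restricted Gaussian Y-channel, with channel coefficients $h_1,h_2,h_3\in\mathbb{R}$, user power $P\ge 0$ and relay power $P_r\ge 0$. For all distinct $j,k\in\{1,2,3\}$, user $j$ has a message $m_{jk}$ for user $k$, and the six messages are independent, $m_{jk}$ being uniformly distributed on $\{1,\dots,\lfloor 2^{nR_{jk}}\rfloor\}$, with $R_{jk}\ge 0$. In a code of length $n$, for $\{j,k,l\}=\{1,2,3\}$, user $j$ sends a codeword $X_j^n=f_j(m_{jk},m_{jl})\in\mathbb{R}^n$ that depends only on its own messages, with $\frac1n\sum_{i=1}^n\mathbb{E}[X_{ji}^2]\le P$. For $i=1,\dots,n$ the relay receives $Y_{ri}=h_1X_{1i}+h_2X_{2i}+h_3X_{3i}+Z_{ri}$ and sends $X_{ri}=f_{r,i}(Y_{r1},\dots,Y_{r,i-1})$, with $\frac1n\sum_{i=1}^n\mathbb{E}[X_{ri}^2]\le P_r$, and user $j$ receives $Y_{ji}=h_jX_{ri}+Z_{ji}$. The noises $Z_{ri},Z_{1i},Z_{2i},Z_{3i}$, $i=1,\dots,n$, are i.i.d. $\mathcal{N}(0,1)$ and independent of the messages. User $j$ decodes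 $(\hat m_{kj},\hat m_{lj})=g_j(Y_j^n,m_{jk},m_{jl})$, and an error occurs if some user decodes one of its two messages incorrectly. The functions $f_{r,i}$ and $g_j$ are measurable. A rate tuple $(R_{jk})_{j\ne k}$ with nonnegative entries is achievable if there is a sequence of such codes, one for each length $n$, whose error probability tends to $0$ as $n\to\infty$. **Lemma.** If $(R_{jk})_{j\neq k}$ is achievable in the restricted Y-channel, then for all distinct $j,k,l\in\{1,2,3\}$ $$R_{kj}+R_{lj}+R_{kl}\le C(h_k^2P+h_l^2P),\qquad\text{where } C(x)=\tfrac12\log_2(1+x).$$ -/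

import Mathlib

open MeasureTheory ProbabilityTheory Filter Topology

namespace YChannel

/-- The function `C(x) = (1/2) log (1 + x)`. Rates are measured in bits, so the logarithm is
binary. -/
noncomputable def capFn (x : ℝ) : ℝ := (1 / 2) * Real.logb 2 (1 + x)

/-- The message set `{1, …, 2^(n R_jk)}` of the message `m_jk` from user `j` to user `k`, that is,
a set with `⌊2^(n R_jk)⌋` elements. The three users are indexed by `Fin 3`; only the entries `R j k`
with `j ≠ k` of the rate array `R` are ever used. -/
abbrev MsgSet (R : Fin 3 → Fin 3 → ℝ) (n : ℕ) (j k : Fin 3) : Type :=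
  Fin ⌊(2 : ℝ) ^ ((n : ℝ) * R j k)⌋₊

/-- The pair of messages `(m_jk, m_jl)` that user `j` sends to the two other users. -/
abbrev SentMsgs (R : Fin 3 → Fin 3 → ℝ) (n : ℕ) (j : Fin 3) : Type :=
  (k : {k : Fin 3 // k ≠ j}) → MsgSet R n j k

/-- The pair of messages `(m_kj, m_lj)` that user `j` has to decode. -/
abbrev WantedMsgs (R : Fin 3 → Fin 3 → ℝ) (n : ℕ) (j : Fin 3) : Type :=
  (k : {k : Fin 3 // k ≠ j}) → MsgSet R n k j

/-- All six messages. -/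
abbrev Messages (R : Fin 3 → Fin 3 → ℝ) (n : ℕ) : Type :=
  (j : Fin 3) → SentMsgs R n j

/-- The sample space of `n` channel uses: the six messages `ω.1`, the noise `ω.2.1` at the relay,
and the noises `ω.2.2 j` at the users `j`. -/
abbrev Sample (R : Fin 3 → Fin 3 → ℝ) (n : ℕ) : Type :=
  Messages R n × (Fin n → ℝ) × (Fin 3 → Fin n → ℝ)

/-- The joint law of messages and noises: the messages are independent and uniformly distributed,
and independent of the noises, which are i.i.d. standard Gaussian over all nodes and times. -/
noncomputable def law (R : Fin 3 → Fin 3 → ℝ) (n : ℕ) : Measure (Sample R n) :=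
  (uniformOn (Set.univ : Set (Messages R n))).prod
    ((Measure.pi fun _ : Fin n => gaussianReal 0 1).prod
      (Measure.pi fun _ : Fin 3 => Measure.pi fun _ : Fin n => gaussianReal 0 1))

/-- The coding functions of a code of rates `R` and length `n` for the restricted Y-channel.
* The codeword `x_j^n` of user `j` is a function of the messages of user `j` only.
* The relay symbol at time `i` is a function of the symbols received by the relay before time `i`.
* User `j` decodes from its received sequence `y_j^n` and its own messages. -/
structure RestrictedCode (R : Fin 3 → Fin 3 → ℝ) (n : ℕ) where
  enc : (j : Fin 3) → SentMsgs R n j → Fin n → ℝ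
  relay : (i : Fin n) → (Fin i → ℝ) → ℝ
  measurable_relay : ∀ i, Measurable (relay i)
  dec : (j : Fin 3) → (Fin n → ℝ) → SentMsgs R n j → WantedMsgs R n j
  measurable_dec : ∀ j w, Measurable fun y => dec j y w

namespace RestrictedCode

variable {R : Fin 3 → Fin 3 → ℝ} {n : ℕ} (c : RestrictedCode R n) (h : Fin 3 → ℝ)

/-- The symbol `x_ji` sent by user `j` at time `i`. -/
def userSignal (j : Fin 3) (i : Fin n) (ω : Sample R n) : ℝ := c.enc j (ω.1 j) i

/-- The symbol `y_ri = h_1 x_1i + h_2 x_2i + h_3 x_3i + z_ri` received by the relay. -/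
def relayReceived (i : Fin n) (ω : Sample R n) : ℝ :=
  (∑ j, h j * c.userSignal j i ω) + ω.2.1 i

/-- The symbol `x_ri` sent by the relay, computed from `y_r1, …, y_r(i-1)`. -/
def relaySignal (i : Fin n) (ω : Sample R n) : ℝ :=
  c.relay i fun t : Fin i => c.relayReceived h (Fin.castLE i.isLt.le t) ω

/-- The symbol `y_ji = h_j x_ri + z_ji` received by user `j`. -/
def userReceived (j : Fin 3) (i : Fin n) (ω : Sample R n) : ℝ :=
  h j * c.relaySignal h i ω + ω.2.2 j i

/-- The event that some user decodes some of its wanted messages incorrectly. -/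
def errorEvent : Set (Sample R n) :=
  {ω | ∃ j : Fin 3, c.dec j (fun i => c.userReceived h j i ω) (ω.1 j) ≠
    fun k : {k : Fin 3 // k ≠ j} => ω.1 k ⟨j, k.2.symm⟩}

/-- The average error probability. -/
noncomputable def errorProb : ℝ := (law R n).real (c.errorEvent h)

end RestrictedCode

/-- The power constraint `(1/n) ∑ E[X_i ^ 2] ≤ P`, including that these second moments are
finite. -/
def PowerConstraint {Ω : Type*} [MeasurableSpace Ω] (μ : Measure Ω) {n : ℕ}
    (X : Fin n → Ω → ℝ) (P : ℝ) : Prop :=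
  (∀ i, Integrable (fun ω => X i ω ^ 2) μ) ∧
    (1 / (n : ℝ)) * ∑ i, ∫ ω, X i ω ^ 2 ∂μ ≤ P

/-- The rates `R j k ≥ 0`, `j ≠ k`, are achievable in the restricted Y-channel with channel
coefficients `h`, user power `P` and relay power `Pr`: there is a sequence of codes, one of each
length `n`, that obey the power constraints and have an average error probability that tends to
zero. -/
def RestrictedAchievable (h : Fin 3 → ℝ) (P Pr : ℝ) (R : Fin 3 → Fin 3 → ℝ) : Prop :=
  (∀ j k, j ≠ k → 0 ≤ R j k) ∧
    ∃ c : (n : ℕ) → RestrictedCode R n,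
      (∀ n, (∀ j, PowerConstraint (law R n) ((c n).userSignal j) P) ∧
        PowerConstraint (law R n) ((c n).relaySignal h) Pr) ∧
      Tendsto (fun n => (c n).errorProb h) atTop (𝓝 0)

end YChannel

/-! Genie argument: hand user `j` the word received by the relay, all user noises and the message
from `l` to `k`. Simulating its own decoder, it finds the messages from `k` and `l` to `j`; now
knowing everything `l` sent, it simulates the decoder of `l` and finds the message from `k` to `l`.
Three messages are thus recovered from the two-user signal `h k * X_k + h l * X_l` plus noise
(`eq_of_mem_genieEvent`). Instead of mutual information, the converse compares two laws of that
noisy signal: the true one given the messages, and one Gaussian law `q` not depending on the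
messages, with variance `v = 1 + h k ^ 2 * P + h l ^ 2 * P`. Under `q` the average success
probability is at most `1 / M`, with `M` the number of values of the three messages
(`sum_measureReal_genieEvent_mul_le`). The relative entropy to `q`, averaged over messages, is at
most `n / 2 * log v`, because the two codewords are independent. Data processing
(`mul_measureReal_gaussian_le`) then bounds `(1 - error) * log M` by this quantity plus `log 2`;
dividing by `n` and letting `n → ∞` gives the claim. -/

namespace YChannel

open scoped NNReal ENNReal

/-! ### Relative entropy between Gaussians and change of measure -/

/-- The logarithm of the density of `N(m, 1)` with respect to `N(a, v)`. -/
noncomputable def gaussianLLR (m a : ℝ) (v : ℝ≥0) (x : ℝ) : ℝ :=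
  (1 / 2) * Real.log v + (x - a) ^ 2 / (2 * v) - (x - m) ^ 2 / 2

@[fun_prop]
lemma measurable_gaussianLLR (m a : ℝ) (v : ℝ≥0) : Measurable (gaussianLLR m a v) := by
  unfold gaussianLLR
  fun_prop

lemma gaussianReal_eq_withDensity_exp_neg_llr (m a : ℝ) {v : ℝ≥0} (hv : v ≠ 0) :
    gaussianReal a v =
      (gaussianReal m 1).withDensity fun x => ENNReal.ofReal (Real.exp (-gaussianLLR m a v x)) := by
  rw [gaussianReal_of_var_ne_zero _ hv, gaussianReal_of_var_ne_zero _ one_ne_zero,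
    ← withDensity_mul _ (measurable_gaussianPDF _ _) (by fun_prop)]
  congr 1
  ext x
  have hv' : (0 : ℝ) < v := by positivity
  rw [Pi.mul_apply, gaussianPDF, gaussianPDF, ← ENNReal.ofReal_mul (gaussianPDFReal_nonneg _ _ _)]
  congr 1
  have hsq : Real.exp (-((1 / 2) * Real.log v)) = (√(v : ℝ))⁻¹ := by
    rw [Real.exp_neg, mul_comm, ← Real.rpow_def_of_pos hv', ← Real.sqrt_eq_rpow]
  simp only [gaussianPDFReal, gaussianLLR]
  rw [show -(1 / 2 * Real.log v + (x - a) ^ 2 / (2 * v) - (x - m) ^ 2 / 2) =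
    -(1 / 2 * Real.log v) + (-(x - a) ^ 2 / (2 * v) + (x - m) ^ 2 / 2) by ring, Real.exp_add, hsq,
    Real.sqrt_mul (by positivity) (v : ℝ), mul_inv, NNReal.coe_one, mul_one, mul_assoc, mul_assoc,
    mul_left_comm (Real.exp _), ← Real.exp_add]
  congr 3
  ring

/-- On a box the indicator times the product density splits into one factor per coordinate; the
coordinates are independent, so the integral splits too. -/
lemma pi_withDensity {ι : Type*} [Fintype ι] {X : ι → Type*} [∀ i, MeasurableSpace (X i)]
    (μ : (i : ι) → Measure (X i)) [∀ i, IsProbabilityMeasure (μ i)]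
    (f : (i : ι) → X i → ℝ≥0∞) (hf : ∀ i, Measurable (f i))
    [∀ i, SigmaFinite ((μ i).withDensity (f i))] :
    Measure.pi (fun i => (μ i).withDensity (f i)) =
      (Measure.pi μ).withDensity fun x => ∏ i, f i (x i) := by
  refine Measure.pi_eq fun s hs => ?_
  rw [withDensity_apply _ (MeasurableSet.univ_pi hs), ← lintegral_indicator (MeasurableSet.univ_pi hs)]
  have hind : ∀ x : (i : ι) → X i, (Set.univ.pi s).indicator (fun x => ∏ i, f i (x i)) x =
      ∏ i, (s i).indicator (f i) (x i) := by
    intro x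
    by_cases hx : x ∈ Set.univ.pi s
    · rw [Set.indicator_of_mem hx]
      exact Finset.prod_congr rfl fun i _ => (Set.indicator_of_mem (hx i trivial) _).symm
    · rw [Set.indicator_of_notMem hx]
      simp only [Set.mem_pi, Set.mem_univ, true_imp_iff, not_forall] at hx
      obtain ⟨i, hi⟩ := hx
      exact (Finset.prod_eq_zero (Finset.mem_univ i) (Set.indicator_of_notMem hi _)).symm
  have hm : ∀ i, Measurable ((s i).indicator (f i)) := fun i => (hf i).indicator (hs i)
  simp_rw [hind]
  rw [lintegral_prod_eq_prod_lintegral_of_indepFun Finset.univ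
    (fun i (x : (i : ι) → X i) => (s i).indicator (f i) (x i))
    (iIndepFun_pi fun i => (hm i).aemeasurable) fun i => (hm i).comp (measurable_pi_apply i)]
  refine Finset.prod_congr rfl fun i _ => ?_
  rw [withDensity_apply _ (hs i), ← lintegral_indicator (hs i),
    ← (measurePreserving_eval μ i).lintegral_comp (hm i)]

lemma pi_gaussianReal_eq_withDensity {n : ℕ} (m a : Fin n → ℝ) {v : ℝ≥0} (hv : v ≠ 0) :
    Measure.pi (fun i => gaussianReal (a i) v) =
      (Measure.pi fun i => gaussianReal (m i) 1).withDensity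
        fun x => ENNReal.ofReal (Real.exp (-∑ i, gaussianLLR (m i) (a i) v (x i))) := by
  have h1 : ∀ i, gaussianReal (a i) v = (gaussianReal (m i) 1).withDensity
      fun x => ENNReal.ofReal (Real.exp (-gaussianLLR (m i) (a i) v x)) :=
    fun i => gaussianReal_eq_withDensity_exp_neg_llr _ _ hv
  have : ∀ i, SigmaFinite ((gaussianReal (m i) 1).withDensity
      fun x => ENNReal.ofReal (Real.exp (-gaussianLLR (m i) (a i) v x))) :=
    fun i => by rw [← h1 i]; infer_instance
  simp_rw [h1]
  rw [pi_withDensity (fun i => gaussianReal (m i) 1)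
    (fun i x => ENNReal.ofReal (Real.exp (-gaussianLLR (m i) (a i) v x))) fun i => by fun_prop]
  congr 1
  ext x
  rw [← Finset.sum_neg_distrib, Real.exp_sum, ENNReal.ofReal_prod_of_nonneg fun i _ => by positivity]

lemma integrable_sub_sq_gaussianReal (m b : ℝ) (v : ℝ≥0) :
    Integrable (fun x => (x - b) ^ 2) (gaussianReal m v) :=
  ((memLp_id_gaussianReal 2).sub (memLp_const b)).integrable_sq

lemma integral_sub_sq_gaussianReal (m b : ℝ) (v : ℝ≥0) :
    ∫ x, (x - b) ^ 2 ∂gaussianReal m v = (m - b) ^ 2 + v := by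
  have hm := integral_id_gaussianReal (μ := m) (v := v)
  have hv := variance_id_gaussianReal (μ := m) (v := v)
  rw [variance_eq_integral aemeasurable_id] at hv
  simp only [id_eq, hm] at hv
  have hid : Integrable (fun x : ℝ => x) (gaussianReal m v) :=
    (memLp_id_gaussianReal 1).integrable le_rfl
  have hi := integrable_sub_sq_gaussianReal m m v
  have hc : Integrable (fun x : ℝ => 2 * (m - b) * (x - m)) (gaussianReal m v) :=
    (hid.sub (integrable_const m)).const_mul _
  have hlin : Integrable (fun x : ℝ => 2 * (m - b) * (x - m) + (m - b) ^ 2) (gaussianReal m v) :=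
    hc.add (integrable_const _)
  calc ∫ x, (x - b) ^ 2 ∂gaussianReal m v
      = ∫ x, ((x - m) ^ 2 + (2 * (m - b) * (x - m) + (m - b) ^ 2)) ∂gaussianReal m v := by
        congr 1; ext x; ring
    _ = (m - b) ^ 2 + v := by
        rw [integral_add hi hlin, hv, integral_add hc
          (integrable_const _), integral_const_mul, integral_sub hid (integrable_const m), hm]
        simp [add_comm]

lemma integrable_gaussianLLR (m a : ℝ) (v : ℝ≥0) :
    Integrable (gaussianLLR m a v) (gaussianReal m 1) := by
  have h1 := (integrable_sub_sq_gaussianReal m a 1).div_const (2 * v)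
  have h2 := (integrable_sub_sq_gaussianReal m m 1).div_const 2
  exact ((integrable_const _).add h1).sub h2

/-- This is the relative entropy of `N(m, 1)` from `N(a, v)`. It is affine in `(m - a) ^ 2`, so its
average over codewords involves only their second moment about `a`. -/
lemma integral_gaussianLLR (m a : ℝ) (v : ℝ≥0) :
    ∫ x, gaussianLLR m a v x ∂gaussianReal m 1 =
      (1 / 2) * Real.log v + ((m - a) ^ 2 + 1) / (2 * v) - 1 / 2 := by
  have h1 := (integrable_sub_sq_gaussianReal m a 1).div_const (2 * v)
  have h2 := (integrable_sub_sq_gaussianReal m m 1).div_const 2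
  have h0 : Integrable (fun x => (1 / 2) * Real.log v + (x - a) ^ 2 / (2 * v)) (gaussianReal m 1) :=
    (integrable_const _).add h1
  unfold gaussianLLR
  rw [integral_sub h0 h2, integral_add (integrable_const _) h1,
    integral_div, integral_div, integral_sub_sq_gaussianReal, integral_sub_sq_gaussianReal]
  simp

/-- A binary form of the data processing inequality for the relative entropy `∫ ℓ dp` of `p` with
respect to `q = exp (-ℓ) p`. -/
lemma mul_measureReal_le_integral_llr {α : Type*} [MeasurableSpace α] (p q : Measure α)
    [IsProbabilityMeasure p] [IsProbabilityMeasure q] {ℓ : α → ℝ} (hℓ : Integrable ℓ p)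
    (hmeas : Measurable ℓ)
    (hq : q = p.withDensity fun x => ENNReal.ofReal (Real.exp (-ℓ x))) (T : ℝ)
    {B : Set α} (hB : MeasurableSet B) :
    T * p.real B ≤ (∫ x, ℓ x ∂p) + Real.log 2 - 1 + (1 + (Real.exp T - 1) * q.real B) / 2 := by
  have hg : Integrable (fun x => 1 + (Real.exp T - 1) * B.indicator (fun _ => (1 : ℝ)) x) q :=
    (integrable_const _).add (((integrable_const _).indicator hB).const_mul _)
  have hqi : ∫ x, (1 + (Real.exp T - 1) * B.indicator (fun _ => (1 : ℝ)) x) ∂q =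
      1 + (Real.exp T - 1) * q.real B := by
    rw [integral_add (integrable_const _) (((integrable_const _).indicator hB).const_mul _),
      integral_const_mul, integral_indicator_const _ hB]
    simp
  have hd : Measurable fun x => Real.toNNReal (Real.exp (-ℓ x)) := by fun_prop
  have hq' : q = p.withDensity fun x => (Real.toNNReal (Real.exp (-ℓ x)) : ℝ≥0∞) := hq
  have hgp : Integrable (fun x => Real.exp (-ℓ x) *
      (1 + (Real.exp T - 1) * B.indicator (fun _ => (1 : ℝ)) x)) p := by
    rw [hq', integrable_withDensity_iff_integrable_smul hd] at hg
    refine hg.congr (ae_of_all _ fun x => ?_)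
    simp only [NNReal.smul_def, Real.coe_toNNReal _ (Real.exp_nonneg _), smul_eq_mul]
  have hpi : ∫ x, Real.exp (-ℓ x) *
      (1 + (Real.exp T - 1) * B.indicator (fun _ => (1 : ℝ)) x) ∂p =
      1 + (Real.exp T - 1) * q.real B := by
    rw [← hqi]
    conv_rhs => rw [hq', integral_withDensity_eq_integral_smul hd]
    refine integral_congr_ae (ae_of_all _ fun x => ?_)
    simp only [NNReal.smul_def, Real.coe_toNNReal _ (Real.exp_nonneg _), smul_eq_mul]
  have hind : Integrable (fun x => T * B.indicator (fun _ => (1 : ℝ)) x) p :=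
    ((integrable_const _).indicator hB).const_mul _
  have hpB : ∫ x, T * B.indicator (fun _ => (1 : ℝ)) x ∂p = T * p.real B := by
    rw [integral_const_mul, integral_indicator_const _ hB]
    simp
  have hℓ' : Integrable (fun x => ℓ x + (Real.log 2 - 1)) p := hℓ.add (integrable_const _)
  have hle : ∫ x, T * B.indicator (fun _ => (1 : ℝ)) x ∂p ≤
      ∫ x, (ℓ x + (Real.log 2 - 1) + (Real.exp (-ℓ x) *
      (1 + (Real.exp T - 1) * B.indicator (fun _ => (1 : ℝ)) x)) / 2) ∂p := by
    refine integral_mono hind (hℓ'.add (hgp.div_const 2)) fun x => ?_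
    -- The Donsker–Varadhan bound with the logarithm replaced by its tangent at `2`. This keeps the
    -- result affine in `q.real B`, so it can be summed over messages; `2` bounds `1 + (exp T - 1) *
    -- q.real B` when `q.real B ≤ exp (-T)`.
    have hkey : ∀ t : ℝ, t ≤ ℓ x + (Real.log 2 - 1) + (Real.exp (-ℓ x) * Real.exp t) / 2 := by
      intro t
      have := Real.add_one_le_exp (t - ℓ x - Real.log 2)
      rw [Real.exp_sub, Real.exp_log two_pos, sub_eq_neg_add t, Real.exp_add] at this
      linarith
    by_cases hx : x ∈ B
    · simpa [hx] using hkey T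
    · simpa [hx] using hkey 0
  rw [hpB, integral_add hℓ' (hgp.div_const 2),
    integral_add hℓ (integrable_const _), integral_div, hpi] at hle
  simp at hle
  linarith

/-- The relative entropy bound for a shifted standard Gaussian vector, in the presence of further
independent randomness `κ`. -/
lemma mul_measureReal_gaussian_le {n : ℕ} {Z : Type*} [MeasurableSpace Z] (κ : Measure Z)
    [IsProbabilityMeasure κ] (m a : Fin n → ℝ) {v : ℝ≥0} (hv : v ≠ 0) (T : ℝ)
    {B : Set ((Fin n → ℝ) × Z)} (hB : MeasurableSet B) :
    T * ((Measure.pi fun _ : Fin n => gaussianReal 0 1).prod κ).real {x | (m + x.1, x.2) ∈ B} ≤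
      (∑ i, ((1 / 2) * Real.log v + ((m i - a i) ^ 2 + 1) / (2 * v) - 1 / 2)) + Real.log 2 - 1 +
        (1 + (Real.exp T - 1) *
          ((Measure.pi fun i => gaussianReal (a i) v).prod κ).real B) / 2 := by
  have hmap : (Measure.pi fun _ : Fin n => gaussianReal 0 1).map (fun x => m + x) =
      Measure.pi fun i => gaussianReal (m i) 1 := by
    have h1 : ∀ i, (gaussianReal 0 1).map (fun x => m i + x) = gaussianReal (m i) 1 := by
      intro i
      rw [gaussianReal_map_const_add, zero_add]
    have : ∀ i, SigmaFinite ((gaussianReal 0 1).map (fun x => m i + x)) :=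
      fun i => by rw [h1 i]; infer_instance
    have := Measure.pi_map_pi (μ := fun _ : Fin n => gaussianReal 0 1)
      (f := fun i x => m i + x) fun i => by fun_prop
    simp_rw [h1] at this
    exact this
  have hpres : MeasurePreserving (Prod.map (fun x => m + x) id)
      ((Measure.pi fun _ : Fin n => gaussianReal 0 1).prod κ)
      ((Measure.pi fun i => gaussianReal (m i) 1).prod κ) :=
    MeasurePreserving.prod ⟨by fun_prop, hmap⟩ (MeasurePreserving.id κ)
  have hpB : ((Measure.pi fun _ : Fin n => gaussianReal 0 1).prod κ).real
      {x | (m + x.1, x.2) ∈ B} = ((Measure.pi fun i => gaussianReal (m i) 1).prod κ).real B :=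
    hpres.measureReal_preimage hB.nullMeasurableSet
  have hcomp : ∀ i, Integrable (fun x : Fin n → ℝ => gaussianLLR (m i) (a i) v (x i))
      (Measure.pi fun i => gaussianReal (m i) 1) := fun i =>
    (measurePreserving_eval (fun i => gaussianReal (m i) 1) i).integrable_comp_of_integrable
      (integrable_gaussianLLR (m i) (a i) v)
  have hint : Integrable (fun x : Fin n → ℝ => ∑ i, gaussianLLR (m i) (a i) v (x i))
      (Measure.pi fun i => gaussianReal (m i) 1) := integrable_finsetSum _ fun i _ => hcomp i
  have hI : ∫ x, ∑ i, gaussianLLR (m i) (a i) v (x.1 i)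
      ∂((Measure.pi fun i => gaussianReal (m i) 1).prod κ) =
      ∑ i, ((1 / 2) * Real.log v + ((m i - a i) ^ 2 + 1) / (2 * v) - 1 / 2) := by
    rw [integral_fun_fst (f := fun x : Fin n → ℝ => ∑ i, gaussianLLR (m i) (a i) v (x i)),
      integral_finsetSum _ fun i _ => hcomp i]
    simp only [probReal_univ, one_smul]
    refine Finset.sum_congr rfl fun i _ => ?_
    rw [integral_comp_eval (μ := fun i => gaussianReal (m i) 1)
      (integrable_gaussianLLR (m i) (a i) v).aestronglyMeasurable, integral_gaussianLLR]
  have hq : (Measure.pi fun i => gaussianReal (a i) v).prod κ =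
      ((Measure.pi fun i => gaussianReal (m i) 1).prod κ).withDensity fun x =>
        ENNReal.ofReal (Real.exp (-∑ i, gaussianLLR (m i) (a i) v (x.1 i))) := by
    rw [pi_gaussianReal_eq_withDensity m a hv, prod_withDensity_left (by fun_prop)]
  have := mul_measureReal_le_integral_llr _ _ (hint.comp_fst κ) (by fun_prop) hq T hB
  rwa [hI, ← hpB] at this

/-! ### Variance under uniform laws on finite products -/

section FiniteProducts

variable {ι : Type*} [Fintype ι] [DecidableEq ι] {A : ι → Type*} [∀ i, Fintype (A i)]

/-- Independence of coordinates in summed form: it kills the cross terms in the variance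
computations. -/
lemma sum_pi_mul_eq_zero (k : ι) {F : A k → ℝ} (hF : ∑ x, F x = 0)
    (G : ((i : {i // i ≠ k}) → A i) → ℝ) :
    ∑ m : (i : ι) → A i, F (m k) * G (fun i => m i) = 0 := by
  have := Fintype.sum_equiv (Equiv.piSplitAt k A)
    (fun m => F (m k) * G (fun i => m i)) (fun p => F p.1 * G p.2) fun m => rfl
  rw [this, Fintype.sum_prod_type, ← Finset.sum_mul_sum, hF, zero_mul]

lemma sum_sub_mean_eq_zero {X : Type*} [Fintype X] [Nonempty X] (f : X → ℝ) :
    ∑ x, (f x - (∑ y, f y) / Fintype.card X) = 0 := by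
  rw [Finset.sum_sub_distrib, Finset.sum_const, Finset.card_univ, nsmul_eq_mul,
    mul_div_cancel₀ _ (by positivity), sub_self]

lemma sum_pi_sub_mean_sq_le (k : ι) [Nonempty (A k)] (f : A k → ℝ) :
    ∑ m : (i : ι) → A i, (f (m k) - (∑ y, f y) / Fintype.card (A k)) ^ 2 ≤
      ∑ m : (i : ι) → A i, f (m k) ^ 2 := by
  set c := (∑ y, f y) / Fintype.card (A k)
  have h0 := sum_pi_mul_eq_zero k (F := fun x => f x - c) (sum_sub_mean_eq_zero f) fun _ => 2 * c
  calc ∑ m : (i : ι) → A i, (f (m k) - c) ^ 2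
      ≤ ∑ m : (i : ι) → A i, ((f (m k) - c) ^ 2 + (f (m k) - c) * (2 * c) + c ^ 2) := by
        simp only [Finset.sum_add_distrib]
        rw [h0, add_zero]
        exact le_add_of_nonneg_right (Finset.sum_nonneg fun _ _ => sq_nonneg c)
    _ = ∑ m : (i : ι) → A i, f (m k) ^ 2 := Finset.sum_congr rfl fun m _ => by ring

/-- The variance of a linear combination of functions of two different coordinates under the
uniform law of a finite product is at most that of the combination of the second moments. -/
lemma sum_pi_linear_combination_sub_mean_sq_le {k l : ι} (hkl : k ≠ l) [Nonempty (A k)]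
    [Nonempty (A l)] (f : A k → ℝ) (g : A l → ℝ) (a b : ℝ) :
    ∑ m : (i : ι) → A i, (a * f (m k) + b * g (m l) -
      (a * ((∑ y, f y) / Fintype.card (A k)) + b * ((∑ y, g y) / Fintype.card (A l)))) ^ 2 ≤
      a ^ 2 * ∑ m : (i : ι) → A i, f (m k) ^ 2 + b ^ 2 * ∑ m : (i : ι) → A i, g (m l) ^ 2 := by
  have hf := sum_pi_sub_mean_sq_le k f
  have hg := sum_pi_sub_mean_sq_le l g
  set c := (∑ y, f y) / Fintype.card (A k)
  set d := (∑ y, g y) / Fintype.card (A l)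
  have h0 := sum_pi_mul_eq_zero k (F := fun x => f x - c) (sum_sub_mean_eq_zero f)
    fun r => 2 * a * b * (g (r ⟨l, hkl.symm⟩) - d)
  calc ∑ m : (i : ι) → A i, (a * f (m k) + b * g (m l) - (a * c + b * d)) ^ 2
      = ∑ m : (i : ι) → A i, (a ^ 2 * (f (m k) - c) ^ 2 + b ^ 2 * (g (m l) - d) ^ 2 +
          (f (m k) - c) * (2 * a * b * (g (m l) - d))) :=
        Finset.sum_congr rfl fun m _ => by ring
    _ = a ^ 2 * ∑ m : (i : ι) → A i, (f (m k) - c) ^ 2 +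
          b ^ 2 * ∑ m : (i : ι) → A i, (g (m l) - d) ^ 2 := by
        simp only [Finset.sum_add_distrib, Finset.mul_sum]
        rw [h0, add_zero]
    _ ≤ _ := by gcongr

end FiniteProducts

/-! ### Uniform laws on finite types -/

section UniformOn

variable {X Y : Type*} [Fintype X] [MeasurableSpace X] [MeasurableSingletonClass X]
  [MeasurableSpace Y]

lemma uniformOn_univ_real_singleton (x : X) :
    (uniformOn (Set.univ : Set X)).real {x} = (Fintype.card X : ℝ)⁻¹ := by
  rw [measureReal_def, uniformOn_univ, Measure.count_singleton, one_div, ENNReal.toReal_inv,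
    ENNReal.toReal_natCast]

lemma integral_uniformOn_univ (f : X → ℝ) :
    ∫ x, f x ∂uniformOn (Set.univ : Set X) = (Fintype.card X : ℝ)⁻¹ * ∑ x, f x := by
  rw [integral_fintype Integrable.of_finite]
  simp_rw [uniformOn_univ_real_singleton, smul_eq_mul, Finset.mul_sum]

lemma measurableSet_of_slices {s : Set (X × Y)} (hs : ∀ x, MeasurableSet (Prod.mk x ⁻¹' s)) :
    MeasurableSet s := by
  have : s = ⋃ x, {x} ×ˢ (Prod.mk x ⁻¹' s) := by
    ext ⟨x, y⟩
    simp
  rw [this]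
  exact MeasurableSet.iUnion fun x => (measurableSet_singleton x).prod (hs x)

lemma uniformOn_univ_prod_real (ν : Measure Y) [IsProbabilityMeasure ν] {s : Set (X × Y)}
    (hs : ∀ x, MeasurableSet (Prod.mk x ⁻¹' s)) :
    ((uniformOn (Set.univ : Set X)).prod ν).real s =
      (Fintype.card X : ℝ)⁻¹ * ∑ x, ν.real (Prod.mk x ⁻¹' s) := by
  rw [measureReal_def, Measure.prod_apply (measurableSet_of_slices hs), ← integral_uniformOn_univ,
    ← integral_toReal (measurable_of_countable _).aemeasurable (ae_of_all _ fun x => measure_lt_top _ _)]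
  rfl

end UniformOn

/-! ### Sizes of the message sets -/

variable {R : Fin 3 → Fin 3 → ℝ} {n : ℕ}

lemma card_msgSet (j k : Fin 3) :
    Fintype.card (MsgSet R n j k) = ⌊(2 : ℝ) ^ ((n : ℝ) * R j k)⌋₊ := Fintype.card_fin _

lemma one_le_card_msgSet {j k : Fin 3} (hR : 0 ≤ R j k) : 1 ≤ Fintype.card (MsgSet R n j k) := by
  rw [card_msgSet, Nat.one_le_floor_iff]
  exact Real.one_le_rpow one_le_two (by positivity)

lemma nonempty_sentMsgs (hR : ∀ j k, j ≠ k → 0 ≤ R j k) (j : Fin 3) :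
    Nonempty (SentMsgs R n j) :=
  ⟨fun k => Classical.choice (Fintype.card_pos_iff.1 (one_le_card_msgSet (hR j k k.2.symm)))⟩

/-- Rounding down a real number that is at least `1` loses at most a factor `2`. -/
lemma mul_log_two_sub_le_log_card_msgSet {j k : Fin 3} (hR : 0 ≤ R j k) :
    n * R j k * Real.log 2 - Real.log 2 ≤ Real.log (Fintype.card (MsgSet R n j k)) := by
  have h1 : (1 : ℝ) ≤ Fintype.card (MsgSet R n j k) := by exact_mod_cast one_le_card_msgSet hR
  have h2 : (2 : ℝ) ^ ((n : ℝ) * R j k) ≤ 2 * Fintype.card (MsgSet R n j k) := by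
    have := (Nat.lt_floor_add_one ((2 : ℝ) ^ ((n : ℝ) * R j k))).le
    rw [card_msgSet] at h1 ⊢
    linarith
  have h3 := Real.log_le_log (by positivity) h2
  rw [Real.log_rpow two_pos, Real.log_mul two_ne_zero (by positivity)] at h3
  linarith

lemma card_sentMsgs {j k l : Fin 3} (hjk : j ≠ k) (hjl : j ≠ l) (hkl : k ≠ l) :
    Fintype.card (SentMsgs R n k) =
      Fintype.card (MsgSet R n k j) * Fintype.card (MsgSet R n k l) := by
  have huniv : (Finset.univ : Finset {i : Fin 3 // i ≠ k}) = {⟨j, hjk⟩, ⟨l, hkl.symm⟩} := by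
    ext ⟨i, hi⟩
    simp only [Finset.mem_univ, Finset.mem_insert, Finset.mem_singleton, Subtype.mk.injEq, true_iff]
    omega
  rw [Fintype.card_pi, huniv, Finset.prod_pair (by simpa using hjl)]

/-! ### The genie-aided decoder -/

namespace RestrictedCode

variable (c : RestrictedCode R n) (h : Fin 3 → ℝ)

/-- The word sent by the relay when it receives the word `y`. -/
def relayOutput (y : Fin n → ℝ) (i : Fin n) : ℝ :=
  c.relay i fun t : Fin i => y (Fin.castLE i.isLt.le t)

@[fun_prop]
lemma measurable_relayOutput (i : Fin n) : Measurable fun y => c.relayOutput y i :=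
  (c.measurable_relay i).comp (by fun_prop)

/-- The received words `y` at the relay and the noises `z` for which user `j` decodes correctly
the messages `m`. -/
def decodeEvent (j : Fin 3) (m : Messages R n) : Set ((Fin n → ℝ) × (Fin 3 → Fin n → ℝ)) :=
  {x | c.dec j (fun i => h j * c.relayOutput x.1 i + x.2 j i) (m j) =
    fun k : {k : Fin 3 // k ≠ j} => m k ⟨j, k.2.symm⟩}

lemma measurableSet_decodeEvent (j : Fin 3) (m : Messages R n) :
    MeasurableSet (c.decodeEvent h j m) :=
  ((c.measurable_dec j (m j)).comp (by fun_prop)) (measurableSet_singleton _)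

/-- The event that users `j` and `l` decode correctly the messages `m`, in terms of the word
received by the relay after subtraction of the signal of user `j`. -/
def genieEvent (j l : Fin 3) (m : Messages R n) : Set ((Fin n → ℝ) × (Fin 3 → Fin n → ℝ)) :=
  {x | ((fun i => h j * c.enc j (m j) i + x.1 i, x.2) : (Fin n → ℝ) × (Fin 3 → Fin n → ℝ)) ∈
    c.decodeEvent h j m ∩ c.decodeEvent h l m}

lemma measurableSet_genieEvent (j l : Fin 3) (m : Messages R n) :
    MeasurableSet (c.genieEvent h j l m) :=
  measurableSet_preimage (by fun_prop)
    ((c.measurableSet_decodeEvent h j m).inter (c.measurableSet_decodeEvent h l m))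

/-- With the messages of user `j`, the message from `l` to `k` and the word received by the relay,
one recovers all messages. -/
lemma eq_of_mem_genieEvent {j k l : Fin 3} (hjk : j ≠ k) (hjl : j ≠ l) (hkl : k ≠ l)
    {m m' : Messages R n} {x : (Fin n → ℝ) × (Fin 3 → Fin n → ℝ)}
    (hm : x ∈ c.genieEvent h j l m) (hm' : x ∈ c.genieEvent h j l m') (hj : m j = m' j)
    (hlk : m l ⟨k, hkl⟩ = m' l ⟨k, hkl⟩) : m = m' := by
  obtain ⟨h1, h2⟩ := hm
  obtain ⟨h1', h2'⟩ := hm'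
  simp only [decodeEvent, Set.mem_ofPred_eq, ← hj] at h1 h2 h1' h2'
  -- User `j` sees the same received word and holds the same own messages in both cases, so its
  -- decoded pairs agree.
  have hw := h1.symm.trans h1'
  have hl : m l = m' l := by
    funext ⟨i, hi⟩
    obtain rfl | rfl : i = j ∨ i = k := by omega
    · exact congrFun hw ⟨l, hi.symm⟩
    · exact hlk
  -- Once `m l = m' l`, the decoder of user `l` also has identical inputs.
  rw [← hl] at h2'
  have hw' := h2.symm.trans h2'
  have hk : m k = m' k := by
    funext ⟨i, hi⟩
    obtain rfl | rfl : i = j ∨ i = l := by omega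
    · exact congrFun hw ⟨k, hi.symm⟩
    · exact congrFun hw' ⟨k, hi.symm⟩
  funext i
  obtain rfl | rfl | rfl : i = j ∨ i = k ∨ i = l := by omega
  all_goals assumption

open Classical in
-- Overwriting the three messages that the genie-aided decoder recovers is injective on the good
-- tuples: what remains, together with `x`, determines the original tuple.
lemma card_genieEvent_mul_le {j k l : Fin 3} (hjk : j ≠ k) (hjl : j ≠ l) (hkl : k ≠ l)
    (x : (Fin n → ℝ) × (Fin 3 → Fin n → ℝ)) :
    (Finset.univ.filter fun m : Messages R n => x ∈ c.genieEvent h j l m).card *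
      (Fintype.card (SentMsgs R n k) * Fintype.card (MsgSet R n l j)) ≤
      Fintype.card (Messages R n) := by
  rw [← Fintype.card_prod, ← Finset.card_univ (α := SentMsgs R n k × MsgSet R n l j),
    ← Finset.card_product]
  refine Finset.card_le_card_of_injOn (t := Finset.univ) (fun p => Function.update
    (Function.update p.1 k p.2.1) l (Function.update (p.1 l) ⟨j, hjl⟩ p.2.2))
    (fun _ _ => Finset.mem_coe.2 (Finset.mem_univ _)) ?_
  rintro ⟨m, w, a⟩ hm ⟨m', w', a'⟩ hm' heq
  simp only [Finset.coe_product, Set.mem_prod, Finset.coe_filter, Finset.mem_univ, true_and,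
    Set.mem_ofPred_eq] at hm hm'
  have hj := congrFun heq j
  have hk := congrFun heq k
  have hl := congrFun heq l
  simp only [Function.update_of_ne hjl, Function.update_of_ne hjk, Function.update_of_ne hkl,
    Function.update_self] at hj hk hl
  have hlj := congrFun hl ⟨j, hjl⟩
  have hlk := congrFun hl ⟨k, hkl⟩
  have hne : (⟨k, hkl⟩ : {i : Fin 3 // i ≠ l}) ≠ ⟨j, hjl⟩ := by simpa using hjk.symm
  simp only [Function.update_self, Function.update_of_ne hne] at hlj hlk
  rw [c.eq_of_mem_genieEvent h hjk hjl hkl hm.1 hm'.1 hj hlk, hk, hlj]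

/-- When the word received by the relay does not depend on the messages, a genie-aided decoder can
do no better than to guess. -/
lemma sum_measureReal_genieEvent_mul_le {j k l : Fin 3} (hjk : j ≠ k) (hjl : j ≠ l) (hkl : k ≠ l)
    (q : Measure ((Fin n → ℝ) × (Fin 3 → Fin n → ℝ))) [IsProbabilityMeasure q] :
    (∑ m, q.real (c.genieEvent h j l m)) *
      (Fintype.card (SentMsgs R n k) * Fintype.card (MsgSet R n l j)) ≤
      Fintype.card (Messages R n) := by
  classical
  have hi : ∀ m, Integrable ((c.genieEvent h j l m).indicator fun _ => (1 : ℝ)) q :=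
    fun m => (integrable_const _).indicator (c.measurableSet_genieEvent h j l m)
  have hsum : ∑ m, q.real (c.genieEvent h j l m) =
      ∫ x, ∑ m, (c.genieEvent h j l m).indicator (fun _ => (1 : ℝ)) x ∂q := by
    rw [integral_finsetSum _ fun m _ => hi m]
    refine Finset.sum_congr rfl fun m _ => ?_
    rw [integral_indicator_const _ (c.measurableSet_genieEvent h j l m)]
    simp
  rw [hsum, ← integral_mul_const]
  calc _ ≤ ∫ _, (Fintype.card (Messages R n) : ℝ) ∂q := by
        refine integral_mono ((integrable_finsetSum _ fun m _ => hi m).mul_const _)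
          (integrable_const _) fun x => ?_
        have := c.card_genieEvent_mul_le h hjk hjl hkl x
        simp only [Set.indicator_apply, Finset.sum_boole]
        exact_mod_cast this
    _ = _ := by simp

/-- The part of the received word of the relay that comes from the users `k` and `l`. -/
def pairSignal (k l : Fin 3) (m : Messages R n) (i : Fin n) : ℝ :=
  h k * c.enc k (m k) i + h l * c.enc l (m l) i

/-- Adding the signal of user `j` back to the noisy pair signal gives exactly the word received by
the relay. -/
lemma mem_genieEvent_of_notMem_errorEvent {j k l : Fin 3} (hjk : j ≠ k) (hjl : j ≠ l) (hkl : k ≠ l)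
    {ω : Sample R n} (hω : ω ∉ c.errorEvent h) :
    (c.pairSignal h k l ω.1 + ω.2.1, ω.2.2) ∈ c.genieEvent h j l ω.1 := by
  have hrec : (fun i => h j * c.enc j (ω.1 j) i + (c.pairSignal h k l ω.1 + ω.2.1) i) =
      fun i => c.relayReceived h i ω := by
    funext i
    have huniv : (Finset.univ : Finset (Fin 3)) = {j, k, l} := by
      ext i
      simp only [Finset.mem_univ, Finset.mem_insert, Finset.mem_singleton, true_iff]
      omega
    rw [relayReceived, huniv, Finset.sum_insert (by simp [hjk, hjl]), Finset.sum_pair hkl]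
    simp only [pairSignal, userSignal, Pi.add_apply]
    ring
  simp only [errorEvent, Set.mem_ofPred_eq, not_exists, not_not] at hω
  rw [genieEvent, Set.mem_ofPred_eq, hrec]
  exact ⟨hω j, hω l⟩

lemma one_sub_errorProb_le [Nonempty (Messages R n)] {j k l : Fin 3} (hjk : j ≠ k) (hjl : j ≠ l)
    (hkl : k ≠ l) :
    Fintype.card (Messages R n) * (1 - c.errorProb h) ≤
      ∑ m : Messages R n, ((Measure.pi fun _ : Fin n => gaussianReal 0 1).prod
        (Measure.pi fun _ : Fin 3 => Measure.pi fun _ : Fin n => gaussianReal 0 1)).real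
          {x | (c.pairSignal h k l m + x.1, x.2) ∈ c.genieEvent h j l m} := by
  set S : Set (Sample R n) :=
    {ω | (c.pairSignal h k l ω.1 + ω.2.1, ω.2.2) ∈ c.genieEvent h j l ω.1} with hS
  have hSm : ∀ m, MeasurableSet (Prod.mk m ⁻¹' S) := fun m =>
    measurableSet_preimage (f := fun x : (Fin n → ℝ) × (Fin 3 → Fin n → ℝ) =>
      (c.pairSignal h k l m + x.1, x.2)) (by fun_prop) (c.measurableSet_genieEvent h j l m)
  have hprob : IsProbabilityMeasure (law R n) := by unfold law; infer_instance
  have hcompl : (law R n).real Sᶜ ≤ c.errorProb h :=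
    measureReal_mono fun ω hω => by
      by_contra hne
      exact hω (c.mem_genieEvent_of_notMem_errorEvent h hjk hjl hkl hne)
  rw [probReal_compl_eq_one_sub (measurableSet_of_slices hSm), law,
    uniformOn_univ_prod_real _ hSm] at hcompl
  have hN : (0 : ℝ) < Fintype.card (Messages R n) := by positivity
  have := mul_le_mul_of_nonneg_left (sub_le_comm.1 hcompl) hN.le
  rwa [mul_inv_cancel_left₀ hN.ne'] at this

/-! ### Power constraint and finite block length converse -/

lemma sum_sum_enc_sq_le [Nonempty (Messages R n)] (hn : 0 < n) {P : ℝ} (k : Fin 3)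
    (hP : PowerConstraint (law R n) (c.userSignal k) P) :
    ∑ i, ∑ m : Messages R n, c.enc k (m k) i ^ 2 ≤ Fintype.card (Messages R n) * (n * P) := by
  have hint : ∀ i, ∫ ω, c.userSignal k i ω ^ 2 ∂law R n =
      (Fintype.card (Messages R n) : ℝ)⁻¹ * ∑ m : Messages R n, c.enc k (m k) i ^ 2 := by
    intro i
    rw [← integral_uniformOn_univ, law]
    exact (integral_fun_fst (f := fun m : Messages R n => c.enc k (m k) i ^ 2)).trans (by simp)
  have h2 := hP.2
  simp_rw [hint, ← Finset.mul_sum] at h2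
  have hN : (0 : ℝ) < Fintype.card (Messages R n) := by positivity
  have hn' : (0 : ℝ) < n := by exact_mod_cast hn
  rw [one_div, inv_mul_le_iff₀ hn', inv_mul_le_iff₀ hN] at h2
  exact h2

/-- The converse bound at a finite block length. -/
theorem one_sub_errorProb_mul_log_le (hR : ∀ j k, j ≠ k → 0 ≤ R j k) (hn : 0 < n) {P : ℝ}
    (hP0 : 0 ≤ P) (hP : ∀ j, PowerConstraint (law R n) (c.userSignal j) P)
    {j k l : Fin 3} (hjk : j ≠ k) (hjl : j ≠ l) (hkl : k ≠ l) :
    (1 - c.errorProb h) *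
      Real.log (Fintype.card (SentMsgs R n k) * Fintype.card (MsgSet R n l j)) ≤
      n * ((1 / 2) * Real.log (1 + (h k ^ 2 * P + h l ^ 2 * P))) + Real.log 2 := by
  have hne : ∀ j, Nonempty (SentMsgs R n j) := nonempty_sentMsgs hR
  have hneM : Nonempty (Messages R n) := inferInstance
  obtain ⟨v, hv⟩ : ∃ v : ℝ≥0, (v : ℝ) = 1 + (h k ^ 2 * P + h l ^ 2 * P) :=
    ⟨⟨1 + (h k ^ 2 * P + h l ^ 2 * P), by positivity⟩, rfl⟩
  have hvpos : (0 : ℝ) < v := by rw [hv]; positivity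
  have hv0 : v ≠ 0 := by
    rintro rfl
    simp at hvpos
  set N : ℝ := (Fintype.card (Messages R n) : ℝ) with hN
  have hNpos : 0 < N := by rw [hN]; positivity
  set M : ℝ := (Fintype.card (SentMsgs R n k) : ℝ) * Fintype.card (MsgSet R n l j) with hM
  have hM1 : 0 < M := by
    have h1 : 0 < Fintype.card (MsgSet R n l j) := one_le_card_msgSet (hR l j hjl.symm)
    rw [hM]
    positivity
  have hlogM : 0 ≤ Real.log M := by
    rw [hM]
    exact_mod_cast Real.log_natCast_nonneg _
  -- The reference law is centred at the mean pair signal, since codewords with nonzero mean would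
  -- otherwise leave a cross term `E[X_k] * E[X_l]`.
  set a : Fin n → ℝ := fun i =>
    h k * ((∑ y, c.enc k y i) / Fintype.card (SentMsgs R n k)) +
      h l * ((∑ y, c.enc l y i) / Fintype.card (SentMsgs R n l))
  set κ : Measure (Fin 3 → Fin n → ℝ) :=
    Measure.pi fun _ : Fin 3 => Measure.pi fun _ : Fin n => gaussianReal 0 1
  set q := (Measure.pi fun i => gaussianReal (a i) v).prod κ
  have hvar : ∑ i, ∑ m, (c.pairSignal h k l m i - a i) ^ 2 ≤ N * (n * (v - 1)) := by
    calc ∑ i, ∑ m, (c.pairSignal h k l m i - a i) ^ 2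
        ≤ ∑ i, (h k ^ 2 * ∑ m : Messages R n, c.enc k (m k) i ^ 2 +
            h l ^ 2 * ∑ m : Messages R n, c.enc l (m l) i ^ 2) :=
          Finset.sum_le_sum fun i _ => sum_pi_linear_combination_sub_mean_sq_le hkl
            (fun y => c.enc k y i) (fun y => c.enc l y i) (h k) (h l)
      _ = h k ^ 2 * ∑ i, ∑ m : Messages R n, c.enc k (m k) i ^ 2 +
            h l ^ 2 * ∑ i, ∑ m : Messages R n, c.enc l (m l) i ^ 2 := by
          rw [Finset.sum_add_distrib, Finset.mul_sum, Finset.mul_sum]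
      _ ≤ h k ^ 2 * (N * (n * P)) + h l ^ 2 * (N * (n * P)) := by
          gcongr
          · exact c.sum_sum_enc_sq_le hn k (hP k)
          · exact c.sum_sum_enc_sq_le hn l (hP l)
      _ = N * (n * (v - 1)) := by rw [hv]; ring
  have hKL : ∑ m, ∑ i, ((1 / 2) * Real.log v +
      ((c.pairSignal h k l m i - a i) ^ 2 + 1) / (2 * v) - 1 / 2) ≤
      N * (n * ((1 / 2) * Real.log v)) := by
    rw [Finset.sum_comm]
    -- The part beyond `log v / 2` is `((x - a) ^ 2 + 1 - v) / (2 * v)`, whose total is nonpositive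
    -- by `hvar`: this is what the choice of `v` achieves.
    calc _ = N * (n * ((1 / 2) * Real.log v)) +
          ((∑ i, ∑ m, (c.pairSignal h k l m i - a i) ^ 2) - N * (n * (v - 1))) / (2 * v) := by
          simp only [add_div, Finset.sum_add_distrib, Finset.sum_sub_distrib, ← Finset.sum_div,
            Finset.sum_const, Finset.card_univ, Fintype.card_fin, nsmul_eq_mul, ← hN]
          field_simp
          ring
      _ ≤ _ := by
          have : ((∑ i, ∑ m, (c.pairSignal h k l m i - a i) ^ 2) - N * (n * (v - 1))) / (2 * v) ≤ 0 :=
            div_nonpos_of_nonpos_of_nonneg (by linarith) (by positivity)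
          linarith
  have hguess : (∑ m, q.real (c.genieEvent h j l m)) * M ≤ N :=
    c.sum_measureReal_genieEvent_mul_le h hjk hjl hkl q
  have hguess0 : 0 ≤ ∑ m, q.real (c.genieEvent h j l m) :=
    Finset.sum_nonneg fun _ _ => measureReal_nonneg
  -- The threshold `T = log M` matches the guessing probability `1 / M` under `q`.
  have hsum := Finset.sum_le_sum fun m (_ : m ∈ Finset.univ) =>
    mul_measureReal_gaussian_le κ (c.pairSignal h k l m) a hv0 (Real.log M)
      (c.measurableSet_genieEvent h j l m)
  rw [← Finset.mul_sum] at hsum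
  have hsucc := mul_le_mul_of_nonneg_left (c.one_sub_errorProb_le h hjk hjl hkl) hlogM
  have hrhs : ∑ m : Messages R n, ((∑ i, ((1 / 2) * Real.log v +
      ((c.pairSignal h k l m i - a i) ^ 2 + 1) / (2 * v) - 1 / 2)) + Real.log 2 - 1 +
        (1 + (Real.exp (Real.log M) - 1) * q.real (c.genieEvent h j l m)) / 2) =
      (∑ m, ∑ i, ((1 / 2) * Real.log v +
        ((c.pairSignal h k l m i - a i) ^ 2 + 1) / (2 * v) - 1 / 2)) + N * (Real.log 2 - 1) +
        (N + (M - 1) * ∑ m, q.real (c.genieEvent h j l m)) / 2 := by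
    rw [Real.exp_log hM1]
    simp only [Finset.sum_add_distrib, Finset.sum_sub_distrib (f := fun m => _ + Real.log 2),
      ← Finset.sum_div, ← Finset.mul_sum,
      Finset.sum_const, Finset.card_univ, nsmul_eq_mul, ← hN, mul_one]
    ring
  have hfin := hsucc.trans (hsum.trans_eq hrhs)
  rw [← hv]
  refine le_of_mul_le_mul_left ?_ hNpos
  -- By `hguess` and `hguess0`, `(M - 1) * ∑ q ≤ N`, so the remainder is at most `N * (log 2 - 1) +
  -- (N + N) / 2 = N * log 2`.
  nlinarith

end RestrictedCode

end YChannel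

/-! ### Passage to the limit in the block length -/

theorem mainTheorem8 (h : Fin 3 → ℝ) (P Pr : ℝ) (hP : 0 ≤ P) (hPr : 0 ≤ Pr)
    (R : Fin 3 → Fin 3 → ℝ) (hR : YChannel.RestrictedAchievable h P Pr R)
    (j k l : Fin 3) (hjk : j ≠ k) (hjl : j ≠ l) (hkl : k ≠ l) :
    R k j + R l j + R k l ≤ YChannel.capFn (h k ^ 2 * P + h l ^ 2 * P) := by
  obtain ⟨hR0, c, hc, hlim⟩ := hR
  have hlog2 : 0 < Real.log 2 := Real.log_pos one_lt_two
  set S := R k j + R l j + R k l with hS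
  set K := (1 / 2) * Real.log (1 + (h k ^ 2 * P + h l ^ 2 * P)) with hK
  have hbound : ∀ᶠ n : ℕ in atTop,
      -- The term `3 * log 2 / n` is the rounding loss of the three message sets, one `log 2` each.
      (1 - (c n).errorProb h) * (S * Real.log 2 - 3 * Real.log 2 / n) ≤ K + Real.log 2 / n := by
    filter_upwards [eventually_gt_atTop 0, hlim.eventually_le_const one_pos] with n hn herr
    have hn' : (0 : ℝ) < n := by exact_mod_cast hn
    have hmain := (c n).one_sub_errorProb_mul_log_le h hR0 hn hP (hc n).1 hjk hjl hkl
    have h1 := YChannel.one_le_card_msgSet (n := n) (hR0 k j hjk.symm)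
    have h2 := YChannel.one_le_card_msgSet (n := n) (hR0 k l hkl)
    have h3 := YChannel.one_le_card_msgSet (n := n) (hR0 l j hjl.symm)
    have hlog : n * (S * Real.log 2 - 3 * Real.log 2 / n) ≤
        Real.log (Fintype.card (YChannel.SentMsgs R n k) *
          Fintype.card (YChannel.MsgSet R n l j)) := by
      rw [YChannel.card_sentMsgs hjk hjl hkl, Nat.cast_mul, Real.log_mul (by positivity)
        (by positivity), Real.log_mul (by positivity) (by positivity), mul_sub,
        mul_div_cancel₀ _ hn'.ne']
      have e1 := YChannel.mul_log_two_sub_le_log_card_msgSet (n := n) (hR0 k j hjk.symm)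
      have e2 := YChannel.mul_log_two_sub_le_log_card_msgSet (n := n) (hR0 k l hkl)
      have e3 := YChannel.mul_log_two_sub_le_log_card_msgSet (n := n) (hR0 l j hjl.symm)
      rw [hS]
      linarith
    have := (mul_le_mul_of_nonneg_left hlog (sub_nonneg.2 herr)).trans hmain
    refine le_of_mul_le_mul_left ?_ hn'
    rw [mul_add, mul_div_cancel₀ _ hn'.ne', mul_left_comm]
    exact this
  have hl : Tendsto (fun n : ℕ => (1 - (c n).errorProb h) *
      (S * Real.log 2 - 3 * Real.log 2 / n)) atTop (𝓝 ((1 - 0) * (S * Real.log 2 - 0))) :=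
    (tendsto_const_nhds.sub hlim).mul
      (tendsto_const_nhds.sub (tendsto_const_div_atTop_nhds_zero_nat _))
  have hr : Tendsto (fun n : ℕ => K + Real.log 2 / n) atTop (𝓝 (K + 0)) :=
    tendsto_const_nhds.add (tendsto_const_div_atTop_nhds_zero_nat _)
  have hle := le_of_tendsto_of_tendsto hl hr hbound
  rw [YChannel.capFn, Real.logb, ← mul_div_assoc, le_div_iff₀ hlog2]
  linarith
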